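/- Let $X_1,X_2,\dots$ be independent, identically distributed, non-negative discrete real random variables (each almost surely takes values in a countable set) with $\mathbb{E}(X_1^2)<\infty$ and $\mathrm{Var}(X_1)>0$. Put $\alpha=[\mathbb{E}(X_1)]^2/\mathrm{Var}(X_1)$, $\beta=\mathrm{Var}(X_1)/\mathbb{E}(X_1)$ and $T_n=\sum_{i=1}^n X_i$. For $a,b>0$ let $G(\cdot\,;a,b)$ be the cumulative distribution function of the gamma distribution with shape $a$ and scale $b$, and for $p\in(0,1)$ let $q_{p;a,b}=\inf\{x\in\mathbb{R}: G(x;a,b)\ge p\}$ be its $p$-quantile. Then for every $p\in(0,1)$, $$\lim_{n\to\infty}\mathbb{P}(T_n<q_{p;n\alpha,\beta})=p.$$ Furthermore, $G(T_n;n\alpha,\beta)$ converges in distribution to $\mathrm{Uniform}(0,1)$ as $n\to\infty$. -/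

import Mathlib

open MeasureTheory ProbabilityTheory Filter Topology

/-- A real random variable `X` is discrete: almost surely it takes its values in some countable
set. -/
def IsDiscreteRV {Ω : Type*} [MeasurableSpace Ω] (P : Measure Ω) (X : Ω → ℝ) : Prop :=
  ∃ S : Set ℝ, S.Countable ∧ ∀ᵐ ω ∂P, X ω ∈ S

/-- The CDF `G(x; a, b)` of the gamma distribution with shape `a > 0` and scale `b > 0`
(Mathlib's `gammaMeasure` takes the shape and the rate `1 / b`). -/
noncomputable def gammaCDF (a b x : ℝ) : ℝ :=
  cdf (gammaMeasure a (1 / b)) x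

/-- The `p`-quantile `inf {x : G(x; a, b) ≥ p}` of the gamma distribution with shape `a` and
scale `b`. -/
noncomputable def gammaQuantile (p a b : ℝ) : ℝ :=
  sInf {x : ℝ | p ≤ gammaCDF a b x}

/-- The law Uniform(0,1) on the real line. -/
noncomputable def uniform01 : Measure ℝ :=
  volume.restrict (Set.Ioo 0 1)

instance isProbabilityMeasure_uniform01 : IsProbabilityMeasure uniform01 :=
  ⟨by simp [uniform01]⟩

/-! The gamma law with shape `n * α` and scale `β` has the mean and variance of `T n`. Centred and
divided by `√n`, both have the same Gaussian limit: `T n` by the central limit theorem, the gamma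
law by its characteristic function (`tendsto_charFun_map_gammaMeasure`). As the limiting CDF is
continuous, applying the gamma CDFs to `T n` gives asymptotically uniform variables
(`tendsto_measureReal_comp_lt`). The quantile claim is the same statement, since `T n` lies below
the `p`-quantile exactly when its gamma CDF value is below `p`. -/

/-! ### Transforms of the gamma law -/

namespace ProbabilityTheory

/-- Tilting a gamma density by `exp (s * x)` gives a multiple of the gamma density with rate `r -
s`. -/
lemma lintegral_exp_mul_gammaMeasure {a r s : ℝ} (ha : 0 < a) (hr : 0 < r) (hs : s < r) :
    ∫⁻ x, ENNReal.ofReal (Real.exp (s * x)) ∂gammaMeasure a r =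
      ENNReal.ofReal ((r / (r - s)) ^ a) := by
  have hrs : 0 < r - s := sub_pos.2 hs
  have hmeas (b q : ℝ) : Measurable (gammaPDF b q) :=
    (measurable_gammaPDFReal b q).ennreal_ofReal
  have hpdf (x : ℝ) : gammaPDF a r x * ENNReal.ofReal (Real.exp (s * x)) =
      ENNReal.ofReal ((r / (r - s)) ^ a) * gammaPDF a (r - s) x := by
    rw [gammaPDF, gammaPDF, ← ENNReal.ofReal_mul (gammaPDFReal_nonneg ha hr x),
      ← ENNReal.ofReal_mul (by positivity)]
    congr 1
    unfold gammaPDFReal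
    split_ifs with hx
    · have hexp : Real.exp (-((r - s) * x)) = Real.exp (-(r * x)) * Real.exp (s * x) := by
        rw [← Real.exp_add]; ring_nf
      have := (Real.rpow_pos_of_pos hrs a).ne'
      rw [hexp, Real.div_rpow hr.le hrs.le]
      field_simp
    · simp
  rw [gammaMeasure, lintegral_withDensity_eq_lintegral_mul _ (hmeas a r) (by fun_prop)]
  simp only [Pi.mul_apply, hpdf]
  rw [lintegral_const_mul _ (hmeas a (r - s)), lintegral_gammaPDF_eq_one ha hrs, mul_one]

lemma integrable_exp_mul_gammaMeasure {a r s : ℝ} (ha : 0 < a) (hr : 0 < r) (hs : s < r) :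
    Integrable (fun x => Real.exp (s * x)) (gammaMeasure a r) := by
  refine (lintegral_ofReal_ne_top_iff_integrable (by fun_prop) (ae_of_all _ fun x => by
    positivity)).1 ?_
  rw [lintegral_exp_mul_gammaMeasure ha hr hs]
  exact ENNReal.ofReal_ne_top

lemma mgf_id_gammaMeasure {a r s : ℝ} (ha : 0 < a) (hr : 0 < r) (hs : s < r) :
    mgf id (gammaMeasure a r) s = (r / (r - s)) ^ a := by
  have hrs : 0 < r - s := sub_pos.2 hs
  rw [mgf, integral_eq_lintegral_of_nonneg_ae (ae_of_all _ fun x => by positivity) (by fun_prop)]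
  simp only [id_eq]
  rw [lintegral_exp_mul_gammaMeasure ha hr hs, ENNReal.toReal_ofReal (by positivity)]

/-- Both sides are analytic on the half-plane, where `1 - z / r` has positive real part, and agree
on real points accumulating at `0`; the identity theorem does the rest. -/
lemma complexMGF_id_gammaMeasure {a r : ℝ} (ha : 0 < a) (hr : 0 < r) {z : ℂ} (hz : z.re < r) :
    complexMGF id (gammaMeasure a r) z = Complex.exp (-a * Complex.log (1 - z / r)) := by
  have hU : IsOpen {z : ℂ | z.re < r} := isOpen_lt Complex.continuous_re continuous_const
  have hsub : Set.Iio r ⊆ integrableExpSet id (gammaMeasure a r) := fun s hs =>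
    integrable_exp_mul_gammaMeasure ha hr hs
  have hmgf : AnalyticOnNhd ℂ (complexMGF id (gammaMeasure a r)) {z : ℂ | z.re < r} :=
    analyticOnNhd_complexMGF.mono fun z hz => interior_maximal hsub isOpen_Iio hz
  have hlog : AnalyticOnNhd ℂ (fun z : ℂ => Complex.exp (-a * Complex.log (1 - z / r)))
      {z : ℂ | z.re < r} := by
    refine DifferentiableOn.analyticOnNhd (fun w hw => ?_) hU
    have hslit : 1 - w / r ∈ Complex.slitPlane := by
      left
      have : w.re / r < 1 := (div_lt_one hr).2 hw
      simpa [Complex.div_ofReal_re] using this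
    refine DifferentiableAt.differentiableWithinAt ?_
    exact (((by fun_prop : DifferentiableAt ℂ (fun w : ℂ => 1 - w / r) w).clog hslit).const_mul
      _).cexp
  have hreal (s : ℝ) (hs : s < r) : complexMGF id (gammaMeasure a r) s =
      Complex.exp (-a * Complex.log (1 - s / r)) := by
    have hrs : 0 < r - s := sub_pos.2 hs
    have h1 : (1 - s / r : ℂ) = ((1 - s / r : ℝ) : ℂ) := by push_cast; rfl
    have h2 : 0 < 1 - s / r := by rw [sub_pos, div_lt_one hr]; exact hs
    have h3 : r / (r - s) = (1 - s / r)⁻¹ := by field_simp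
    rw [complexMGF_ofReal, mgf_id_gammaMeasure ha hr hs, h1, ← Complex.ofReal_log h2.le, h3,
      Real.rpow_def_of_pos (inv_pos.2 h2), Real.log_inv]
    push_cast
    ring_nf
  have hne : Tendsto (fun s : ℝ => (s : ℂ)) (𝓝[≠] 0) (𝓝[≠] 0) := by
    refine tendsto_nhdsWithin_iff.2 ⟨?_, ?_⟩
    · exact (Complex.continuous_ofReal.tendsto' 0 0 (by simp)).mono_left nhdsWithin_le_nhds
    · filter_upwards [self_mem_nhdsWithin] with s hs
      simpa using hs
  have hfreq : ∃ᶠ w : ℂ in 𝓝[≠] 0, complexMGF id (gammaMeasure a r) w =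
      Complex.exp (-a * Complex.log (1 - w / r)) := by
    refine hne.frequently (Eventually.frequently ?_)
    filter_upwards [nhdsWithin_le_nhds (Iio_mem_nhds hr)] with s hs using hreal s hs
  exact hmgf.eqOn_of_preconnected_of_frequently_eq hlog
    (convex_halfSpace_re_lt r).isPreconnected (by simpa using hr) hfreq hz

lemma charFun_gammaMeasure {a r : ℝ} (ha : 0 < a) (hr : 0 < r) (t : ℝ) :
    charFun (gammaMeasure a r) t =
      Complex.exp (-a * Complex.log (1 - t * Complex.I / r)) := by
  rw [← complexMGF_id_mul_I, complexMGF_id_gammaMeasure ha hr (by simpa using hr)]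

end ProbabilityTheory

/-- Second-order Taylor expansion of the logarithm: the cubic remainder times `n` is of order `1 /
√n`. -/
lemma tendsto_natCast_mul_log_one_add_div_sqrt_sub (c : ℂ) :
    Tendsto (fun n : ℕ => (n : ℂ) * (Complex.log (1 + c / (√n : ℝ)) - c / (√n : ℝ))) atTop
      (𝓝 (-c ^ 2 / 2)) := by
  have hsqrt : Tendsto (fun n : ℕ => √(n : ℝ)) atTop atTop :=
    Real.tendsto_sqrt_atTop.comp tendsto_natCast_atTop_atTop
  have hinv : Tendsto (fun n : ℕ => ((√n : ℝ) : ℂ)⁻¹) atTop (𝓝 0) := by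
    have := (Complex.continuous_ofReal.tendsto' 0 0 (by simp)).comp hsqrt.inv_tendsto_atTop
    refine this.congr fun n => by simp
  have hw : Tendsto (fun n : ℕ => c / (√n : ℝ)) atTop (𝓝 0) := by
    simpa [div_eq_mul_inv] using hinv.const_mul c
  have hO := (Complex.log_sub_logTaylor_isBigO 2).comp_tendsto hw
  have hO' := (Asymptotics.isBigO_refl (fun n : ℕ => (n : ℂ)) atTop).mul hO
  have hlim : Tendsto (fun n : ℕ => (n : ℂ) * (c / (√n : ℝ)) ^ 3) atTop (𝓝 0) := by
    have := hinv.const_mul (c ^ 3)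
    rw [mul_zero] at this
    refine this.congr' ?_
    filter_upwards [eventually_gt_atTop 0] with n hn
    have h0 : ((√n : ℝ) : ℂ) ≠ 0 := by
      have : 0 < √(n : ℝ) := Real.sqrt_pos.2 (by exact_mod_cast hn)
      exact_mod_cast this.ne'
    have h1 : (n : ℂ) = ((√n : ℝ) : ℂ) ^ 2 := by
      have := Real.sq_sqrt (Nat.cast_nonneg (α := ℝ) n)
      exact_mod_cast this.symm
    rw [h1]
    field_simp
  have herr := hO'.trans_tendsto hlim
  have := herr.add_const (-c ^ 2 / 2)
  rw [zero_add] at this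
  refine this.congr' ?_
  filter_upwards [eventually_gt_atTop 0] with n hn
  have h0 : ((√n : ℝ) : ℂ) ≠ 0 := by
    have : 0 < √(n : ℝ) := Real.sqrt_pos.2 (by exact_mod_cast hn)
    exact_mod_cast this.ne'
  have h1 : (n : ℂ) = ((√n : ℝ) : ℂ) ^ 2 := by
    have := Real.sq_sqrt (Nat.cast_nonneg (α := ℝ) n)
    exact_mod_cast this.symm
  simp only [Function.comp_apply, Complex.logTaylor_succ, Complex.logTaylor_zero, Pi.add_apply]
  rw [h1]
  push_cast
  field_simp
  ring

/-- The rescaled gamma laws with shape `n * α` and scale `β` have characteristic functions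
converging to that of a centred Gaussian law. -/
lemma tendsto_charFun_map_gammaMeasure {α β : ℝ} (hα : 0 < α) (hβ : 0 < β) (t : ℝ) :
    Tendsto (fun n : ℕ => charFun
        ((gammaMeasure (n * α) (1 / β)).map fun y => (√(n : ℝ))⁻¹ * (y - n * (α * β))) t) atTop
      (𝓝 (charFun (gaussianReal 0 (α * β ^ 2).toNNReal) t)) := by
  have hlim := ((tendsto_natCast_mul_log_one_add_div_sqrt_sub
    (-(t * β * Complex.I))).const_mul (-(α : ℂ))).cexp
  rw [charFun_gaussianReal, Real.coe_toNNReal _ (by positivity)]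
  convert! hlim.congr' ?_ using 2
  · push_cast
    rw [neg_sq, mul_pow, Complex.I_sq]
    ring_nf
  · filter_upwards [eventually_gt_atTop 0] with n hn
    have hn' : (0 : ℝ) < n := by exact_mod_cast hn
    have hmap : (gammaMeasure (n * α) (1 / β)).map (fun y => (√(n : ℝ))⁻¹ * (y - n * (α * β))) =
        ((gammaMeasure (n * α) (1 / β)).map (fun y => (√(n : ℝ))⁻¹ * y)).map
          (fun y => y + (-(√(n : ℝ) * (α * β)))) := by
      rw [Measure.map_map (by fun_prop) (by fun_prop)]
      congr 1
      ext y
      have h1 : (n : ℝ) = √n ^ 2 := (Real.sq_sqrt hn'.le).symm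
      have h0 : √(n : ℝ) ≠ 0 := (Real.sqrt_pos.2 hn').ne'
      simp only [Function.comp_apply]
      nth_rw 2 [h1]
      field_simp
      ring
    rw [hmap, charFun_map_add_const, charFun_map_mul, charFun_gammaMeasure (by positivity)
      (by positivity), ← Complex.exp_add]
    congr 1
    have h0 : ((√n : ℝ) : ℂ) ≠ 0 := by exact_mod_cast (Real.sqrt_pos.2 hn').ne'
    have hβ0 : (β : ℂ) ≠ 0 := by exact_mod_cast hβ.ne'
    have h1 : (n : ℂ) = ((√n : ℝ) : ℂ) ^ 2 := by
      exact_mod_cast (Real.sq_sqrt hn'.le).symm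
    have harg : (1 : ℂ) - ((√(n : ℝ))⁻¹ * t : ℝ) * Complex.I / ((1 / β : ℝ) : ℂ) =
        1 + -(t * β * Complex.I) / (√n : ℝ) := by
      push_cast
      field_simp
      ring
    rw [harg]
    simp only [RCLike.inner_apply, conj_trivial]
    push_cast
    have h2 : (n : ℂ) * (-(t * β * Complex.I) / (√n : ℝ)) =
        -(t * β * Complex.I) * (√n : ℝ) := by
      rw [h1]; field_simp
    linear_combination (-(α : ℂ)) * (-1 : ℂ) * h2

/-! ### Convergence of distribution functions -/

lemma MeasureTheory.TendstoInDistribution.tendsto_measureReal_le {Ω' : Type*} {Ω : ℕ → Type*}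
    [∀ n, MeasurableSpace (Ω n)] [MeasurableSpace Ω'] {P : ∀ n, Measure (Ω n)} {P' : Measure Ω'}
    [∀ n, IsProbabilityMeasure (P n)] [IsProbabilityMeasure P'] {Y : ∀ n, Ω n → ℝ} {Z : Ω' → ℝ}
    (h : TendstoInDistribution Y atTop Z P P') (x : ℝ) (hx : P'.map Z {x} = 0) :
    Tendsto (fun n => (P n).real {ω | Y n ω ≤ x}) atTop (𝓝 ((P'.map Z).real (Set.Iic x))) := by
  have key := ProbabilityMeasure.tendsto_measure_of_null_frontier_of_tendsto' h.tendsto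
    (E := Set.Iic x) (by simpa [frontier_Iic] using hx)
  have := (ENNReal.tendsto_toReal (measure_ne_top (ProbabilityMeasure.toMeasure _) _)).comp key
  refine this.congr fun n => ?_
  simp only [Function.comp_apply, ProbabilityMeasure.coe_mk]
  rw [Measure.map_apply_of_aemeasurable (h.forall_aemeasurable n) measurableSet_Iic]
  rfl

/-- Asymptotic probability integral transform: if the laws of `S n` and the monotone functions
`F n` converge pointwise to the same continuous distribution function, then `F n (S n)` is
asymptotically uniform. -/
lemma tendsto_measureReal_comp_lt {Ω : Type*} [MeasurableSpace Ω] {P : Measure Ω}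
    [IsFiniteMeasure P] {S : ℕ → Ω → ℝ} {F : ℕ → ℝ → ℝ} {Φ : ℝ → ℝ}
    (hF : ∀ n, Monotone (F n)) (hΦ : Continuous Φ) (hbot : Tendsto Φ atBot (𝓝 0))
    (htop : Tendsto Φ atTop (𝓝 1)) (hFΦ : ∀ x, Tendsto (fun n => F n x) atTop (𝓝 (Φ x)))
    (hSΦ : ∀ x, Tendsto (fun n => P.real {ω | S n ω ≤ x}) atTop (𝓝 (Φ x)))
    {p : ℝ} (hp : p ∈ Set.Ioo (0 : ℝ) 1) :
    Tendsto (fun n => P.real {ω | F n (S n ω) < p}) atTop (𝓝 p) := by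
  have hsurj {c : ℝ} (hc : c ∈ Set.Ioo (0 : ℝ) 1) : ∃ z, Φ z = c := by
    obtain ⟨x, hx⟩ := (hbot.eventually (gt_mem_nhds hc.1)).exists
    obtain ⟨y, hy⟩ := (htop.eventually (lt_mem_nhds hc.2)).exists
    exact mem_range_of_exists_le_of_exists_ge hΦ ⟨x, hx.le⟩ ⟨y, hy.le⟩
  refine tendsto_order.2 ⟨fun c hc => ?_, fun c hc => ?_⟩
  -- With `Φ z = d < p`, eventually `F n z < p`, so `S n ≤ z` forces `F n (S n) < p`, and the former
  -- has probability tending to `d > c`. The `max` keeps `d` in the range of `Φ`.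
  · obtain ⟨d, hd, hdp⟩ := exists_between (max_lt hc hp.1)
    obtain ⟨z, rfl⟩ := hsurj ⟨(le_max_right _ _).trans_lt hd, hdp.trans hp.2⟩
    filter_upwards [(hFΦ z).eventually (gt_mem_nhds hdp),
      (hSΦ z).eventually (lt_mem_nhds ((le_max_left _ _).trans_lt hd))] with n h1 h2
    exact h2.trans_le (measureReal_mono fun ω hω => (hF n hω).trans_lt h1)
  -- Symmetrically, with `Φ z = d > p`, the event `F n (S n) < p` eventually forces `S n ≤ z`.
  · obtain ⟨d, hpd, hd⟩ := exists_between (lt_min hc hp.2)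
    obtain ⟨z, rfl⟩ := hsurj ⟨hp.1.trans hpd, hd.trans_le (min_le_right _ _)⟩
    filter_upwards [(hFΦ z).eventually (lt_mem_nhds hpd),
      (hSΦ z).eventually (gt_mem_nhds (hd.trans_le (min_le_left _ _)))] with n h1 h2
    refine (measureReal_mono fun ω hω => ?_).trans_lt h2
    by_contra hlt
    exact (h1.trans_le (hF n (not_le.1 hlt).le)).not_gt hω

/-- Differences give convergence on half-open intervals, a π-system containing arbitrarily small
neighbourhoods of every point. -/
lemma tendsto_probabilityMeasure_of_tendsto_Iio {μ : ℕ → ProbabilityMeasure ℝ}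
    {ν : ProbabilityMeasure ℝ}
    (h : ∀ x, Tendsto (fun n => (μ n : Measure ℝ).real (Set.Iio x)) atTop
      (𝓝 ((ν : Measure ℝ).real (Set.Iio x)))) :
    Tendsto μ atTop (𝓝 ν) := by
  refine (isPiSystem_Ico (id : ℝ → ℝ) (id : ℝ → ℝ)).tendsto_probabilityMeasure_of_tendsto_of_mem
    ?_ ?_ ?_
  · rintro s ⟨a, b, -, rfl⟩
    exact measurableSet_Ico
  · intro u hu x hx
    obtain ⟨ε, hε, hball⟩ := Metric.isOpen_iff.1 hu x hx
    refine ⟨Set.Ico (x - ε / 2) (x + ε / 2), ⟨x - ε / 2, x + ε / 2, ?_, rfl⟩,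
      Ico_mem_nhds (by linarith) (by linarith), fun y hy => hball ?_⟩
    · simp only [id_eq]; linarith
    · rw [Metric.mem_ball, Real.dist_eq, abs_lt]
      constructor <;> linarith [hy.1, hy.2]
  · rintro s ⟨a, b, hab, rfl⟩
    have hIco (ρ : ProbabilityMeasure ℝ) : (ρ : Measure ℝ).real (Set.Ico a b) =
        (ρ : Measure ℝ).real (Set.Iio b) - (ρ : Measure ℝ).real (Set.Iio a) := by
      rw [← measureReal_sdiff (Set.Iio_subset_Iio (show a ≤ b from hab.le)) measurableSet_Iio]
      congr 1
      ext y
      simp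
    have := (h b).sub (h a)
    simp only [← hIco] at this
    exact NNReal.tendsto_coe.1 this

lemma measureReal_uniform01_Iio (x : ℝ) : uniform01.real (Set.Iio x) = max 0 (min 1 x) := by
  have : Set.Iio x ∩ Set.Ioo 0 1 = Set.Ioo 0 (min 1 x) := by
    ext y
    simp only [Set.mem_inter_iff, Set.mem_Iio, Set.mem_Ioo, lt_min_iff]
    tauto
  rw [uniform01, measureReal_restrict_apply measurableSet_Iio, this, Real.volume_real_Ioo,
    sub_zero, max_comm]

lemma tendstoInDistribution_uniform01 {Ω : Type*} [MeasurableSpace Ω] {P : Measure Ω}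
    [IsProbabilityMeasure P] {U : ℕ → Ω → ℝ} (hU : ∀ n, AEMeasurable (U n) P) (hU0 : ∀ n ω, 0 ≤ U n ω)
    (h : ∀ p ∈ Set.Ioo (0 : ℝ) 1, Tendsto (fun n => P.real {ω | U n ω < p}) atTop (𝓝 p)) :
    TendstoInDistribution U atTop (fun u : ℝ => u) (fun _ => P) uniform01 where
  forall_aemeasurable := hU
  tendsto := by
    refine tendsto_probabilityMeasure_of_tendsto_Iio fun x => ?_
    simp only [ProbabilityMeasure.coe_mk, Measure.map_id']
    rw [measureReal_uniform01_Iio]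
    have hmap (n : ℕ) : (P.map (U n)).real (Set.Iio x) = P.real {ω | U n ω < x} := by
      rw [measureReal_def, Measure.map_apply_of_aemeasurable (hU n) measurableSet_Iio]
      rfl
    simp only [hmap]
    rcases le_or_gt x 0 with hx0 | hx0
    · have (n : ℕ) : {ω | U n ω < x} = ∅ := by
        ext ω
        simpa using hx0.trans (hU0 n ω)
      simp [this, hx0]
    rcases lt_or_ge x 1 with hx1 | hx1
    · simpa [hx1.le, hx0.le] using h x ⟨hx0, hx1⟩
    · rw [min_eq_left hx1, max_eq_right zero_le_one]
      refine tendsto_order.2 ⟨fun c hc => ?_, fun c hc => .of_forall fun n =>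
        measureReal_le_one.trans_lt hc⟩
      obtain ⟨d, hcd, hd⟩ := exists_between (max_lt hc zero_lt_one)
      filter_upwards [(h d ⟨(le_max_right _ _).trans_lt hcd, hd⟩).eventually
        (lt_mem_nhds ((le_max_left _ _).trans_lt hcd))] with n hn
      exact hn.trans_le (measureReal_mono fun ω hω => lt_of_lt_of_le hω (hd.le.trans hx1))

lemma lt_sInf_setOf_le_cdf_iff (μ : Measure ℝ) {p : ℝ} (hp : p ∈ Set.Ioo (0 : ℝ) 1) (x : ℝ) :
    x < sInf {y | p ≤ cdf μ y} ↔ cdf μ x < p := by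
  have hne : {y | p ≤ cdf μ y}.Nonempty := by
    obtain ⟨y, hy⟩ := ((tendsto_cdf_atTop μ).eventually (lt_mem_nhds hp.2)).exists
    exact ⟨y, hy.le⟩
  have hbdd : BddBelow {y | p ≤ cdf μ y} := by
    obtain ⟨y, hy⟩ := ((tendsto_cdf_atBot μ).eventually (gt_mem_nhds hp.1)).exists
    refine ⟨y, fun z hz => ?_⟩
    by_contra hlt
    exact (hy.trans_le hz).not_ge (monotone_cdf μ (not_le.1 hlt).le)
  refine ⟨fun h => not_le.1 fun hle => (csInf_le hbdd hle).not_gt h, fun h => ?_⟩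
  -- Right continuity keeps the CDF below `p` a little beyond `x`, which makes the inequality with
  -- the infimum strict.
  have hright : ∀ᶠ y in 𝓝[>] x, cdf μ y < p :=
    (((cdf μ).right_continuous x).mono Set.Ioi_subset_Ici_self).eventually (gt_mem_nhds h)
  obtain ⟨y, hy, hxy⟩ := (hright.and self_mem_nhdsWithin).exists
  refine (Set.mem_Ioi.1 hxy).trans_le (le_csInf hne fun z hz => ?_)
  by_contra hlt
  exact (hy.trans_le hz).not_ge (monotone_cdf μ (not_le.1 hlt).le)

lemma continuous_cdf (μ : Measure ℝ) [IsProbabilityMeasure μ] (hμ : ∀ x, μ {x} = 0) :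
    Continuous (cdf μ) := by
  refine continuous_iff_continuousAt.2 fun x => ?_
  rw [(monotone_cdf μ).continuousAt_iff_leftLim_eq_rightLim, StieltjesFunction.rightLim_eq]
  have h := (cdf μ).measure_singleton x
  rw [measure_cdf, hμ x, eq_comm, ENNReal.ofReal_eq_zero] at h
  exact le_antisymm ((monotone_cdf μ).leftLim_le le_rfl) (by linarith)

lemma tendsto_gammaCDF_gaussianReal {α β : ℝ} (hα : 0 < α) (hβ : 0 < β) (x : ℝ) :
    Tendsto (fun n : ℕ => gammaCDF (n * α) β (n * (α * β) + √(n : ℝ) * x)) atTop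
      (𝓝 (cdf (gaussianReal 0 (α * β ^ 2).toNNReal) x)) := by
  have hv : (α * β ^ 2).toNNReal ≠ 0 := by simpa using! (by positivity : 0 < α * β ^ 2)
  have := nullSingletonClass_gaussianReal (μ := 0) hv
  -- The index is shifted because shape `0` does not give a probability measure.
  have hprob (n : ℕ) : IsProbabilityMeasure (gammaMeasure ((n + 1 : ℕ) * α) (1 / β)) :=
    isProbabilityMeasure_gammaMeasure (by positivity) (by positivity)
  have hdist : TendstoInDistribution
      (fun (n : ℕ) (y : ℝ) => (√((n + 1 : ℕ) : ℝ))⁻¹ * (y - (n + 1 : ℕ) * (α * β))) atTop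
      (fun y : ℝ => y) (fun n : ℕ => gammaMeasure ((n + 1 : ℕ) * α) (1 / β))
      (gaussianReal 0 (α * β ^ 2).toNNReal) :=
    { forall_aemeasurable := fun n => by fun_prop
      tendsto := by
        refine ProbabilityMeasure.tendsto_iff_tendsto_charFun.2 fun t => ?_
        simpa only [ProbabilityMeasure.coe_mk, Measure.map_id'] using
          (tendsto_add_atTop_iff_nat 1).2 (tendsto_charFun_map_gammaMeasure hα hβ t) }
  have key := hdist.tendsto_measureReal_le x (by simp)
  rw [Measure.map_id', ← cdf_eq_real] at key
  refine (tendsto_add_atTop_iff_nat 1).1 (key.congr fun n => ?_)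
  have hs : 0 < √((n + 1 : ℕ) : ℝ) := Real.sqrt_pos.2 (by positivity)
  rw [gammaCDF, cdf_eq_real]
  congr 1
  ext y
  rw [Set.mem_ofPred_eq, Set.mem_Iic, inv_mul_le_iff₀ hs, sub_le_iff_le_add']

theorem proposition1 {Ω : Type*} [MeasurableSpace Ω] (P : Measure Ω) [IsProbabilityMeasure P]
    (X : ℕ → Ω → ℝ)
    (hindep : iIndepFun X P)
    (hident : ∀ i, IdentDistrib (X i) (X 0) P P)
    (hnonneg : ∀ i, ∀ᵐ ω ∂P, 0 ≤ X i ω)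
    (hdiscrete : ∀ i, IsDiscreteRV P (X i))
    (hmom : MemLp (X 0) 2 P)
    (hvar : 0 < variance (X 0) P)
    (α β : ℝ)
    (hα : α = (∫ ω, X 0 ω ∂P) ^ 2 / variance (X 0) P)
    (hβ : β = variance (X 0) P / ∫ ω, X 0 ω ∂P)
    (T : ℕ → Ω → ℝ)
    (hT : ∀ n ω, T n ω = ∑ i ∈ Finset.range n, X i ω) :
    (∀ p ∈ Set.Ioo (0 : ℝ) 1,
      Tendsto (fun n : ℕ => P.real {ω | T n ω < gammaQuantile p (n * α) β}) atTop (𝓝 p)) ∧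
    TendstoInDistribution (fun (n : ℕ) (ω : Ω) => gammaCDF (n * α) β (T n ω)) atTop
      (fun u : ℝ => u) (fun _ => P) uniform01 := by
  have hXm (i : ℕ) : AEMeasurable (X i) P := (hident i).aemeasurable_fst
  have hint : Integrable (X 0) P := hmom.integrable (by norm_num)
  have hmean : 0 < ∫ ω, X 0 ω ∂P := by
    refine (integral_nonneg_of_ae (hnonneg 0)).lt_of_ne fun h0 => hvar.ne' ?_
    have hX0 := (integral_eq_zero_iff_of_nonneg_ae (hnonneg 0) hint).1 h0.symm
    rw [variance_congr hX0, variance_zero]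
  have hα0 : 0 < α := by rw [hα]; positivity
  have hβ0 : 0 < β := by rw [hβ]; positivity
  have hαβ : α * β = ∫ ω, X 0 ω ∂P := by rw [hα, hβ]; field_simp
  have hαβ2 : α * β ^ 2 = variance (X 0) P := by rw [hα, hβ]; field_simp
  set γ := gaussianReal 0 (variance (X 0) P).toNNReal with hγ
  have hγ0 : (variance (X 0) P).toNNReal ≠ 0 := by simpa using hvar
  have := nullSingletonClass_gaussianReal (μ := 0) hγ0
  have hclt : TendstoInDistribution
      (fun (n : ℕ) ω => (√n)⁻¹ * (∑ k ∈ Finset.range n, X k ω - n * P[X 0])) atTop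
      (fun y : ℝ => y) (fun _ => P) γ :=
    tendstoInDistribution_inv_sqrt_mul_sum_sub ⟨by fun_prop, Measure.map_id'⟩ hmom hindep hident
  have hS (x : ℝ) := hclt.tendsto_measureReal_le x (by simp [hγ])
  have hF (x : ℝ) := tendsto_gammaCDF_gaussianReal hα0 hβ0 x
  simp only [Measure.map_id', ← cdf_eq_real] at hS
  rw [hαβ2] at hF
  have hU (p : ℝ) (hp : p ∈ Set.Ioo (0 : ℝ) 1) :
      Tendsto (fun n : ℕ => P.real {ω | gammaCDF (n * α) β (T n ω) < p}) atTop (𝓝 p) := by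
    have hmono (n : ℕ) : Monotone fun x => gammaCDF (n * α) β (n * (α * β) + √(n : ℝ) * x) :=
      fun x y hxy => monotone_cdf _ (by gcongr)
    refine (tendsto_measureReal_comp_lt hmono (continuous_cdf γ (by simp [hγ]))
      (tendsto_cdf_atBot γ) (tendsto_cdf_atTop γ) hF hS hp).congr' ?_
    filter_upwards [eventually_gt_atTop 0] with n hn
    have hs : √(n : ℝ) ≠ 0 := (Real.sqrt_pos.2 (by exact_mod_cast hn)).ne'
    have harg (ω : Ω) : n * (α * β) + √(n : ℝ) *
        ((√(n : ℝ))⁻¹ * (∑ k ∈ Finset.range n, X k ω - n * P[X 0])) = T n ω := by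
      rw [mul_inv_cancel_left₀ hs, hαβ, hT]
      ring
    simp only [harg]
  refine ⟨fun p hp => (hU p hp).congr fun n => ?_,
    tendstoInDistribution_uniform01 (fun n => ?_) (fun n ω => cdf_nonneg _ _) hU⟩
  · simp only [gammaQuantile, gammaCDF, lt_sInf_setOf_le_cdf_iff _ hp]
  · have hTm : AEMeasurable (T n) P := by
      rw [funext (hT n)]
      exact Finset.aemeasurable_fun_sum _ fun i _ => hXm i
    exact (monotone_cdf _).measurable.comp_aemeasurable hTm
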